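/- Let G be a finite quiver, that is, a finite directed graph with vertex set V and edge set E, where each edge e has a source s(e) and a target t(e); multiple edges are allowed, and there are no self-loops (s(e) ≠ t(e) for every e). For each vertex v let $n_v \ge 1$ be an integer, for each edge e let $x_e \in \mathbb{C}$ be a weight and let $U_e$ be a complex matrix of size $n_{s(e)} \times n_{t(e)}$. Set $z_v = \sum_{e : s(e) = v} x_e$, and let $\Delta$ be the endomorphism of $\prod_{v \in V} \mathbb{C}^{n_v}$ defined by $$(\Delta f)(v) = \sum_{e : s(e) = v} x_e \big[ f(s(e)) - U_e f(t(e)) \big].$$ Assume that $z_{s(e)} \neq 0$ for every edge e with $x_e \neq 0$ (this is automatic when all weights are nonnegative reals), and put $p_e = x_e / z_{s(e)}$, with the convention $p_e = 0$ if $x_e = z_{s(e)} = 0$. A cycle of G is a nonempty sequence of edges $(e_1, \dots, e_k)$ with $t(e_i) = s(e_{i+1})$ for $1 \le i < k$ and $t(e_k) = s(e_1)$, considered up to cyclic permutation. It is prime if no nontrivial element of $\mathbb{Z}/k\mathbb{Z}$, acting by cyclic permutation, fixes the sequence. Let $\mathcal{P}(G)$ be the set of prime cycles. For a cycle $c$ represented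 by $(e_1, \dots, e_k)$ put $p(c) = p_{e_1} \cdots p_{e_k}$ and $\mathrm{hol}(c) = U_{e_1} \cdots U_{e_k}$, a square matrix of size $n_{s(e_1)}$; the number $\det(I - p(c)\,\mathrm{hol}(c))$ does not depend on the chosen representative. Theorem. If $\mathcal{P}(G)$ is finite, then $$\det \Delta = \Big( \prod_{v \in V} z_v^{n_v} \Big) \prod_{c \in \mathcal{P}(G)} \det\big( I - p(c)\, \mathrm{hol}(c) \big),$$ where the product on the right-hand side is finite. -/

import Mathlib

namespace QuiverEuler

open Quiver

section Cycles

variable {V : Type*} [Quiver V]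

/-- The list of edges `e₁, …, eₖ` traversed by a path, in order. -/
def edgeList {a : V} : ∀ {b : V}, Path a b → List (Total V)
  | _, Path.nil => []
  | _, Path.cons p e => edgeList p ++ [⟨_, _, e⟩]

theorem length_edgeList {a b : V} (p : Path a b) : (edgeList p).length = p.length := by
  induction p with
  | nil => rfl
  | cons p e ih => simp [edgeList, ih]

theorem edgeList_comp {a b c : V} (p : Path a b) (q : Path b c) :
    edgeList (p.comp q) = edgeList p ++ edgeList q := by
  induction q with
  | nil => simp [edgeList]
  | cons q e ih => simp [edgeList, ih]

/-- Any way of cutting the list of edges of a path in two comes from a way of cutting the path. -/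
theorem exists_comp_of_edgeList_eq_append {a b : V} (p : Path a b) (l₁ l₂ : List (Total V))
    (h : edgeList p = l₁ ++ l₂) :
    ∃ (c : V) (q : Path a c) (r : Path c b),
      p = q.comp r ∧ edgeList q = l₁ ∧ edgeList r = l₂ := by
  induction p generalizing l₂ with
  | nil =>
    have h' : l₁ ++ l₂ = [] := h.symm
    obtain ⟨rfl, rfl⟩ := List.append_eq_nil_iff.mp h'
    exact ⟨a, Path.nil, Path.nil, rfl, rfl, rfl⟩
  | cons p e ih =>
    rcases List.eq_nil_or_concat l₂ with rfl | ⟨l, x, rfl⟩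
    · exact ⟨_, p.cons e, Path.nil, rfl, by simpa using h, rfl⟩
    · simp only [edgeList, List.concat_eq_append, ← List.append_assoc] at h
      obtain ⟨h₁, h₂⟩ := List.append_inj' h rfl
      obtain ⟨c, q, r, rfl, hq, hr⟩ := ih l h₁
      refine ⟨c, q, r.cons e, rfl, hq, ?_⟩
      simp only [edgeList, hr, h₂, List.concat_eq_append]

theorem sigma_ext_of_edgeList {a b b' : V} (p : Path a b) (p' : Path a b')
    (h : edgeList p = edgeList p') : (⟨b, p⟩ : Σ b, Path a b) = ⟨b', p'⟩ := by
  induction p generalizing b' with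
  | nil =>
    cases p' with
    | nil => rfl
    | cons p' e' => simp [edgeList] at h
  | cons p e ih =>
    cases p' with
    | nil => simp [edgeList] at h
    | cons p' e' =>
      simp only [edgeList] at h
      obtain ⟨h₁, h₂⟩ := List.append_inj' h rfl
      have h₃ := ih p' h₁
      simp only [List.cons.injEq, and_true, Total.mk.injEq] at h₂
      obtain ⟨rfl, rfl, h₂⟩ := h₂
      obtain rfl := eq_of_heq h₂
      simp only [Sigma.mk.injEq, heq_eq_eq, true_and] at h₃
      rw [h₃]

/-- A nonempty path determines its starting point through its first edge. -/
theorem head?_edgeList_left {a b : V} (p : Path a b) (x : Total V)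
    (h : (edgeList p).head? = some x) : x.left = a := by
  induction p with
  | nil => simp [edgeList] at h
  | cons p e ih =>
    cases p with
    | nil =>
      simp only [edgeList, List.nil_append, List.head?_cons, Option.some.injEq] at h
      rw [← h]
    | cons q f =>
      apply ih
      rw [← h]
      simp [edgeList, List.head?_append]

variable (V) in
/-- A based cycle: a base vertex together with a path of positive length from it to itself. -/
structure BasedCycle where
  base : V
  path : Path base base
  length_pos : 0 < path.length

namespace BasedCycle

/-- The cyclic sequence of edges of a based cycle, listed from the base point. -/
def edges (c : BasedCycle V) : List (Total V) := edgeList c.path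

theorem edges_injective : Function.Injective (edges : BasedCycle V → List (Total V)) := by
  rintro ⟨a, p, hp⟩ ⟨b, q, hq⟩ h
  change edgeList p = edgeList q at h
  have hne : edgeList p ≠ [] := by
    intro h0
    have := length_edgeList p
    simp [h0] at this
    omega
  obtain ⟨x, l, hx⟩ := List.exists_cons_of_ne_nil hne
  have ha : x.left = a := head?_edgeList_left p x (by simp [hx])
  have hb : x.left = b := head?_edgeList_left q x (by simp [← h, hx])
  obtain rfl : a = b := ha.symm.trans hb
  have := sigma_ext_of_edgeList p q h
  simp only [Sigma.mk.injEq, heq_eq_eq, true_and] at this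
  subst this
  rfl

/-- The valuation of a based cycle of length `k`: the order of the stabiliser of its sequence of
edges under the action of `ℤ/kℤ` by cyclic permutations. -/
noncomputable def valuation (c : BasedCycle V) : ℕ :=
  {i : ℕ | i < c.edges.length ∧ c.edges.rotate i = c.edges}.ncard

variable (V) in
/-- Two based cycles are identified when their sequences of edges differ by a cyclic
permutation. -/
def rotationSetoid : Setoid (BasedCycle V) :=
  (List.IsRotated.setoid (Total V)).comap edges

theorem valuation_eq_of_isRotated {c d : BasedCycle V} (h : c.edges ~r d.edges) :
    c.valuation = d.valuation := by
  obtain ⟨n, hn⟩ := h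
  unfold valuation
  rw [← hn]
  congr 1
  ext i
  simp only [Set.mem_ofPred_eq, List.length_rotate]
  refine and_congr_right fun _ => ?_
  rw [List.rotate_rotate, Nat.add_comm, ← List.rotate_rotate]
  exact (List.rotate_eq_rotate).symm

/-- Rotating the base point amounts to exchanging the two halves of the closed path. -/
theorem exists_comp_of_isRotated {c d : BasedCycle V} (h : c.edges ~r d.edges) :
    ∃ (q : Path c.base d.base) (r : Path d.base c.base),
      c.path = q.comp r ∧ d.path = r.comp q := by
  obtain ⟨n, hn, hd⟩ := List.isRotated_iff_mod.mp h
  rw [List.rotate_eq_drop_append_take hn] at hd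
  obtain ⟨b, q, r, hp, hq, hr⟩ := exists_comp_of_edgeList_eq_append c.path
    (c.edges.take n) (c.edges.drop n) (List.take_append_drop n _).symm
  have hpos : 0 < (r.comp q).length := by
    have := c.length_pos
    rw [hp, Path.length_comp] at this
    rw [Path.length_comp]
    omega
  have hd' : d = ⟨b, r.comp q, hpos⟩ := by
    apply edges_injective
    rw [← hd]
    simp [edges, edgeList_comp, hq, hr]
  subst hd'
  exact ⟨q, r, hp, rfl⟩

end BasedCycle

variable (V) in
/-- A cycle of the quiver: a nonempty well-chained closed sequence of edges, up to cyclic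
permutation. -/
def QCycle : Type _ := Quotient (BasedCycle.rotationSetoid V)

/-- The valuation of a cycle. -/
noncomputable def QCycle.valuation (c : QCycle V) : ℕ :=
  Quotient.lift BasedCycle.valuation
    (fun _ _ h => BasedCycle.valuation_eq_of_isRotated h) c

variable (V) in
/-- The set of prime cycles: the cycles of valuation `1`. -/
def primeCycles : Set (QCycle V) := {c | c.valuation = 1}

end Cycles

section Representation

variable {V : Type*} [Quiver V]

/-- The holonomy of a path: the product `U_{e₁} ⋯ U_{eₖ}` of the matrices along its edges. -/
noncomputable def hol {n : V → ℕ}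
    (U : ∀ a b : V, (a ⟶ b) → Matrix (Fin (n a)) (Fin (n b)) ℂ) {a : V} :
    ∀ {b : V}, Path a b → Matrix (Fin (n a)) (Fin (n b)) ℂ
  | _, Path.nil => 1
  | _, Path.cons p e => hol U p * U _ _ e

theorem hol_comp {n : V → ℕ}
    (U : ∀ a b : V, (a ⟶ b) → Matrix (Fin (n a)) (Fin (n b)) ℂ) {a b c : V}
    (p : Path a b) (q : Path b c) : hol U (p.comp q) = hol U p * hol U q := by
  induction q with
  | nil => simp [hol]
  | cons q e ih => simp [hol, ih, Matrix.mul_assoc]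

variable [Fintype V] [∀ a b : V, Fintype (a ⟶ b)]

/-- `z_a`, the total weight of the edges with source `a`. -/
noncomputable def outWeight (x : ∀ a b : V, (a ⟶ b) → ℂ) (a : V) : ℂ :=
  ∑ b, ∑ e : a ⟶ b, x a b e

/-- The normalized weight `p_e = x_e / z_{s(e)}`. -/
noncomputable def normWeight (x : ∀ a b : V, (a ⟶ b) → ℂ) (a b : V) (e : a ⟶ b) : ℂ :=
  x a b e / outWeight x a

/-- The twisted Laplacian, the endomorphism of `∏ v, ℂ^{n v}` given by
`(Δ f)(v) = ∑_{e : s(e) = v} x_e (f(s(e)) - U_e f(t(e)))`. -/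
noncomputable def laplacian {n : V → ℕ} (x : ∀ a b : V, (a ⟶ b) → ℂ)
    (U : ∀ a b : V, (a ⟶ b) → Matrix (Fin (n a)) (Fin (n b)) ℂ) :
    (∀ v, Fin (n v) → ℂ) →ₗ[ℂ] (∀ v, Fin (n v) → ℂ) where
  toFun f v := ∑ w, ∑ e : v ⟶ w, x v w e • (f v - (U v w e).mulVec (f w))
  map_add' f g := by
    funext v
    simp only [Pi.add_apply, ← Finset.sum_add_distrib]
    refine Finset.sum_congr rfl fun w _ => Finset.sum_congr rfl fun e _ => ?_
    rw [Matrix.mulVec_add, ← smul_add]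
    congr 1
    abel
  map_smul' r f := by
    funext v
    simp only [Pi.smul_apply, RingHom.id_apply, Finset.smul_sum]
    refine Finset.sum_congr rfl fun w _ => Finset.sum_congr rfl fun e _ => ?_
    rw [Matrix.mulVec_smul, ← smul_sub, smul_comm]

/-- `det (I - p(c) hol(c))` for a based cycle, where `p(c)` is the product of the normalized
weights of the edges of the cycle. -/
noncomputable def BasedCycle.eulerFactor {n : V → ℕ} (x : ∀ a b : V, (a ⟶ b) → ℂ)
    (U : ∀ a b : V, (a ⟶ b) → Matrix (Fin (n a)) (Fin (n b)) ℂ) (c : BasedCycle V) : ℂ :=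
  (1 - c.path.weight (fun {a b} => normWeight x a b) • hol U c.path).det

theorem BasedCycle.eulerFactor_eq_of_isRotated {n : V → ℕ} (x : ∀ a b : V, (a ⟶ b) → ℂ)
    (U : ∀ a b : V, (a ⟶ b) → Matrix (Fin (n a)) (Fin (n b)) ℂ) {c d : BasedCycle V}
    (h : c.edges ~r d.edges) : c.eulerFactor x U = d.eulerFactor x U := by
  obtain ⟨q, r, hc, hd⟩ := exists_comp_of_isRotated h
  unfold eulerFactor
  rw [hc, hd, Path.weight_comp, Path.weight_comp, hol_comp, hol_comp, mul_comm (r.weight _),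
    ← Matrix.smul_mul, Matrix.det_one_sub_mul_comm, Matrix.mul_smul]

/-- `det (I - p(c) hol(c))` for a cycle; it does not depend on the choice of a base point. -/
noncomputable def QCycle.eulerFactor {n : V → ℕ} (x : ∀ a b : V, (a ⟶ b) → ℂ)
    (U : ∀ a b : V, (a ⟶ b) → Matrix (Fin (n a)) (Fin (n b)) ℂ) (c : QCycle V) : ℂ :=
  Quotient.lift (BasedCycle.eulerFactor x U)
    (fun _ _ h => BasedCycle.eulerFactor_eq_of_isRotated x U h) c

end Representation

end QuiverEuler

namespace QuiverEuler

open scoped PowerSeries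

/-! ### Logarithmic derivatives of characteristic determinants. -/

section LogDerivative

/-! Let `A` be the sum over all edges of the blocks `p_e U_e`, acting on the direct sum of the
fibres. Since `z_{s(e)} p_e = x_e`, the Laplacian is `D (1 - A)` with `D` diagonal and equal to
`z_v` on the fibre of `v` (`det_laplacian`). What remains is an Euler product for `det (1 - A)`.

Introduce a variable `X` and compare `det (1 - X A)` with the product over prime cycles of `det (1 -
X ^ d hol)`, where `d` is the length of the cycle and the weights are absorbed into the holonomy.
Both have constant term 1, so over a field of characteristic zero it is enough that their
logarithmic derivatives agree. By Jacobi's formula these are, up to sign, generating series of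
traces of powers, and the claim becomes an identity for each `tr (A ^ k)` (`trace_transMat_pow`).

To prove that identity, expand `A ^ k` over words of `k` edges. A word that does not close up into a
cycle has trace zero. Every nonempty word is a power of a unique primitive word, and a prime cycle
of length `d` has exactly `d` distinct based representatives with equal traces. This is the source
of the factor `d` on the side of the cycles.

Finiteness of the set of prime cycles makes the product a polynomial in `X`, so that `X = 1` may be
substituted. -/

theorem derivation_prod {R A ι : Type*} [CommRing R] [CommRing A] [Algebra R A] [DecidableEq ι]
    (D : Derivation R A A) (s : Finset ι) (f : ι → A) :
    D (∏ i ∈ s, f i) = ∑ i ∈ s, (∏ j ∈ s.erase i, f j) * D (f i) := by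
  induction s using Finset.induction_on with
  | empty => simp
  | insert a s ha ih =>
    rw [Finset.prod_insert ha, Derivation.leibniz, ih, Finset.sum_insert ha,
      Finset.erase_insert ha, smul_eq_mul, smul_eq_mul, add_comm, Finset.mul_sum]
    congr 1
    refine Finset.sum_congr rfl fun i hi => ?_
    have hia : a ≠ i := fun h => ha (h ▸ hi)
    rw [Finset.erase_insert_of_ne hia, Finset.prod_insert (by simp [ha]), mul_assoc]

/-- Jacobi's formula for a derivation. -/
theorem derivation_det {R A m : Type*} [CommRing R] [CommRing A] [Algebra R A] [Fintype m]
    [DecidableEq m] (D : Derivation R A A) (M : Matrix m m A) :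
    D M.det = (M.adjugate * M.map D).trace := by
  -- Cramer's rule: these are the determinants with one column differentiated, whose sum is the
  -- Leibniz expansion of the derivative.
  have h : ∀ i, (M.adjugate * M.map D) i i = (M.updateCol i fun k => D (M k i)).det := by
    intro i
    rw [← Matrix.cramer_apply, Matrix.cramer_eq_adjugate_mulVec]
    rfl
  simp only [Matrix.trace, Matrix.diag, h, Matrix.det_apply, map_sum, Units.smul_def,
    map_zsmul, derivation_prod]
  rw [Finset.sum_comm]
  refine Finset.sum_congr rfl fun σ _ => ?_
  rw [Finset.smul_sum]
  refine Finset.sum_congr rfl fun i _ => ?_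
  congr 1
  rw [← Finset.prod_erase_mul _ _ (Finset.mem_univ i)]
  congr 1
  · refine Finset.prod_congr rfl fun j hj => ?_
    rw [Matrix.updateCol_ne (Finset.ne_of_mem_erase hj)]
  · simp

variable {m : Type*} [Fintype m] [DecidableEq m] {R : Type*} [CommRing R]

/-- The reciprocal characteristic polynomial of `M`, evaluated at `X ^ d`, as a power series. -/
noncomputable def revSeries (d : ℕ) (M : Matrix m m R) : R⟦X⟧ :=
  (1 - (PowerSeries.X ^ d : R⟦X⟧) • M.map (PowerSeries.C (R := R))).det

/-- The generating series of the traces of the powers of `M`, up to sign the logarithmic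
derivative of `revSeries d M`. -/
noncomputable def traceSeries (d : ℕ) (M : Matrix m m R) : R⟦X⟧ :=
  PowerSeries.mk fun k => if d ∣ k + 1 then (d : R) * (M ^ ((k + 1) / d)).trace else 0

theorem constantCoeff_revSeries {d : ℕ} (hd : d ≠ 0) (M : Matrix m m R) :
    PowerSeries.constantCoeff (revSeries d M) = 1 := by
  rw [revSeries, RingHom.map_det]
  convert Matrix.det_one (n := m) (R := R)
  ext i j
  by_cases h : i = j <;> simp [hd, h, Matrix.one_apply]

/-- Jacobi's formula applies, with the adjugate computed from the explicit inverse of `1 - X ^ d M`,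
a geometric series. -/
theorem derivative_revSeries {d : ℕ} (hd : d ≠ 0) (M : Matrix m m R) :
    PowerSeries.derivative R (revSeries d M) = -(revSeries d M * traceSeries d M) := by
  set N : Matrix m m R⟦X⟧ := M.map (PowerSeries.C (R := R)) with hN
  set B : Matrix m m R⟦X⟧ := 1 - (PowerSeries.X ^ d : R⟦X⟧) • N with hB
  -- The geometric series `∑ X ^ (d q) M ^ q`, inverse to `B`.
  let G : Matrix m m R⟦X⟧ := Matrix.of fun i j =>
    PowerSeries.mk fun k => if d ∣ k then (M ^ (k / d)) i j else 0
  have hNG : ∀ i j, (N * G) i j =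
      PowerSeries.mk fun k => if d ∣ k then (M ^ (k / d + 1)) i j else 0 := by
    intro i j
    ext k
    simp only [Matrix.mul_apply, map_sum, hN, G, Matrix.map_apply, Matrix.of_apply,
      PowerSeries.coeff_C_mul, PowerSeries.coeff_mk]
    split_ifs with h
    · rw [pow_succ', Matrix.mul_apply]
    · simp
  have hBG : B * G = 1 := by
    rw [hB, sub_mul, one_mul, Matrix.smul_mul]
    ext i j k
    rw [Matrix.sub_apply, Matrix.smul_apply, hNG, smul_eq_mul, map_sub,
      PowerSeries.coeff_X_pow_mul']
    simp only [G, Matrix.of_apply, PowerSeries.coeff_mk]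
    rcases Nat.eq_zero_or_pos k with rfl | hk
    · by_cases h : i = j <;> simp [hd, h, Matrix.one_apply]
    · have h1 : PowerSeries.coeff k ((1 : Matrix m m R⟦X⟧) i j) = 0 := by
        by_cases h : i = j <;> simp [h, Matrix.one_apply, PowerSeries.coeff_one, hk.ne']
      rw [h1]
      by_cases hdk : d ∣ k
      · obtain ⟨q, rfl⟩ := hdk
        obtain ⟨q, rfl⟩ : ∃ r, q = r + 1 :=
          Nat.exists_eq_succ_of_ne_zero (by rintro rfl; simp at hk)
        have e : d * (q + 1) - d = d * q := by rw [mul_add, mul_one, Nat.add_sub_cancel]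
        simp [e, Nat.mul_div_cancel_left _ (Nat.pos_of_ne_zero hd), Nat.le_mul_of_pos_right]
      · rw [if_neg hdk]
        split_ifs with h2 h3
        · exact absurd ((Nat.dvd_sub_iff_left h2 dvd_rfl).1 h3) hdk
        · simp
        · simp
  have hadj : B.adjugate = B.det • G := by
    rw [← mul_one B.adjugate, ← hBG, ← mul_assoc, Matrix.adjugate_mul, Matrix.smul_mul, one_mul]
  have hDB : B.map (PowerSeries.derivative R) =
      -(((d : R⟦X⟧) * PowerSeries.X ^ (d - 1)) • N) := by
    ext1 i j
    have h1 : PowerSeries.derivative R ((1 : Matrix m m R⟦X⟧) i j) = 0 := by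
      by_cases h : i = j <;> simp [h, Matrix.one_apply]
    simp only [hB, hN, Matrix.map_apply, Matrix.sub_apply, Matrix.smul_apply, smul_eq_mul,
      map_sub, Matrix.neg_apply, Derivation.leibniz, PowerSeries.derivative_C, h1,
      PowerSeries.derivative_pow, PowerSeries.derivative_X]
    ring
  -- Multiplication by `X ^ (d - 1)` moves the exponents `d q` to `d (q + 1) - 1`, which explains
  -- the `k + 1` in `traceSeries`.
  have hT : ((d : R⟦X⟧) * PowerSeries.X ^ (d - 1)) * (N * G).trace = traceSeries d M := by
    ext k
    simp only [Matrix.trace, Matrix.diag, hNG]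
    rw [mul_assoc, ← nsmul_eq_mul, map_nsmul, PowerSeries.coeff_X_pow_mul', traceSeries,
      PowerSeries.coeff_mk, nsmul_eq_mul]
    simp only [map_sum, PowerSeries.coeff_mk]
    have hd1 : d - 1 + 1 = d := Nat.succ_pred_eq_of_ne_zero hd
    by_cases h : d ∣ k + 1
    · have hle := Nat.le_of_dvd (Nat.succ_pos k) h
      have e : k - (d - 1) = k + 1 - d := by omega
      have h2 : d ∣ k + 1 - d := Nat.dvd_sub h dvd_rfl
      have e2 : (k + 1 - d) / d + 1 = (k + 1) / d := by
        exact (Nat.div_eq_sub_div (Nat.pos_of_ne_zero hd) hle).symm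
      rw [if_pos h, if_pos (by omega)]
      simp [e, h2, e2, Matrix.trace]
    · rw [if_neg h]
      split_ifs with h2 h3
      · exfalso
        have h4 : k + 1 = (k - (d - 1)) + d := by omega
        exact h (h4 ▸ dvd_add h3 dvd_rfl)
      · rw [Finset.sum_const_zero, mul_zero]
      · rw [mul_zero]
  change PowerSeries.derivative R B.det = -(B.det * _)
  rw [derivation_det, hadj, hDB, ← hT, Matrix.mul_neg, Matrix.trace_neg, Matrix.smul_mul,
    Matrix.mul_smul, Matrix.trace_smul, Matrix.trace_smul, Matrix.trace_mul_comm G]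
  simp only [smul_eq_mul]

/-- The quotient `P Q⁻¹` has derivative zero, hence is constant in characteristic zero, and its
constant term is 1. -/
theorem powerSeries_eq_of_logDerivative_eq {K : Type*} [Field K] [CharZero K] {P Q S : K⟦X⟧}
    (hP : PowerSeries.derivative K P = -(P * S)) (hQ : PowerSeries.derivative K Q = -(Q * S))
    (hP1 : PowerSeries.constantCoeff P = 1) (hQ1 : PowerSeries.constantCoeff Q = 1) : P = Q := by
  have hinv : Q * Q⁻¹ = 1 := PowerSeries.mul_inv_cancel _ (by simp [hQ1])
  have h : P * Q⁻¹ = 1 := by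
    refine PowerSeries.derivative.ext ?_ (by simp [hP1, hQ1])
    rw [Derivation.leibniz, PowerSeries.derivative_inv', hP, hQ, PowerSeries.derivative_one,
      smul_eq_mul, smul_eq_mul]
    linear_combination (P * S * Q⁻¹) * hinv
  calc P = P * Q⁻¹ * Q := by rw [mul_assoc, mul_comm Q⁻¹, hinv, mul_one]
    _ = Q := by rw [h, one_mul]

/-- A formal power series cannot be evaluated at 1; the underlying polynomial can. -/
theorem revSeries_eq_coe (d : ℕ) (M : Matrix m m R) :
    revSeries d M = Polynomial.coeToPowerSeries.ringHom
      (1 - (Polynomial.X ^ d : Polynomial R) • M.map Polynomial.C).det := by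
  rw [RingHom.map_det, revSeries]
  congr 1
  ext1 i j
  by_cases hij : i = j <;> simp [hij] <;> exact mul_comm _ _

theorem eval_one_det_one_sub (d : ℕ) (M : Matrix m m R) :
    Polynomial.evalRingHom 1 (1 - (Polynomial.X ^ d : Polynomial R) • M.map Polynomial.C).det =
      (1 - M).det := by
  rw [RingHom.map_det]
  congr 1
  ext1 i j
  by_cases hij : i = j <;> simp [hij]

/-- A determinantal form of the logarithm: an identity between traces of powers integrates to a
product formula. -/
theorem det_one_sub_eq_prod_of_trace_pow {K : Type*} [Field K] [CharZero K] {ι : Type*}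
    (s : Finset ι) {κ : ι → Type*} [∀ i, Fintype (κ i)] [∀ i, DecidableEq (κ i)]
    (A : Matrix m m K) (d : ι → ℕ) (hd : ∀ i, d i ≠ 0) (M : ∀ i, Matrix (κ i) (κ i) K)
    (h : ∀ k : ℕ, 0 < k → (A ^ k).trace =
      ∑ i ∈ s, if d i ∣ k then (d i : K) * (M i ^ (k / d i)).trace else 0) :
    (1 - A).det = ∏ i ∈ s, (1 - M i).det := by
  classical
  have hser : revSeries 1 A = ∏ i ∈ s, revSeries (d i) (M i) := by
    refine powerSeries_eq_of_logDerivative_eq (S := traceSeries 1 A)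
      (derivative_revSeries one_ne_zero A) ?_ (constantCoeff_revSeries one_ne_zero A) ?_
    · have hS : traceSeries 1 A = ∑ i ∈ s, traceSeries (d i) (M i) := by
        ext k
        simp [traceSeries, map_sum, h (k + 1) (Nat.succ_pos k)]
      rw [derivation_prod, hS, Finset.mul_sum, ← Finset.sum_neg_distrib]
      refine Finset.sum_congr rfl fun i hi => ?_
      rw [derivative_revSeries (hd i), ← Finset.prod_erase_mul _ _ hi]
      ring
    · rw [map_prod]
      exact Finset.prod_eq_one fun i _ => constantCoeff_revSeries (hd i) _
  -- The product is finite, so the identity of series is an identity of polynomials.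
  have hpoly : (1 - (Polynomial.X ^ 1 : Polynomial K) • A.map Polynomial.C).det =
      ∏ i ∈ s, (1 - (Polynomial.X ^ d i : Polynomial K) • (M i).map Polynomial.C).det := by
    apply Polynomial.coe_injective
    rw [← Polynomial.coeToPowerSeries.ringHom_apply, ← Polynomial.coeToPowerSeries.ringHom_apply, map_prod,
      ← revSeries_eq_coe, hser]
    exact Finset.prod_congr rfl fun i _ => revSeries_eq_coe _ _
  have := congrArg (Polynomial.evalRingHom 1) hpoly
  rw [map_prod, eval_one_det_one_sub] at this
  rw [this]
  exact Finset.prod_congr rfl fun i _ => eval_one_det_one_sub _ _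

end LogDerivative

/-! ### Primitive words and their powers. -/

section Words

variable {α : Type*}

/-- A word is primitive when it is nonempty and fixed by no nontrivial cyclic permutation. -/
def Primitive (l : List α) : Prop :=
  l ≠ [] ∧ ∀ i < l.length, l.rotate i = l → i = 0

theorem iterate_rotate_one (k : ℕ) (l : List α) :
    (fun w : List α => w.rotate 1)^[k] l = l.rotate k := by
  induction k with
  | zero => simp
  | succ k ih => rw [Function.iterate_succ_apply', ih, List.rotate_rotate]

theorem isPeriodicPt_rotate {k : ℕ} {l : List α} :
    Function.IsPeriodicPt (fun w : List α => w.rotate 1) k l ↔ l.rotate k = l := by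
  rw [Function.IsPeriodicPt, Function.IsFixedPt, iterate_rotate_one]

theorem Primitive.minimalPeriod_eq {l : List α} (h : Primitive l) :
    Function.minimalPeriod (fun w : List α => w.rotate 1) l = l.length := by
  have hp := isPeriodicPt_rotate.2 (List.rotate_length l)
  have hpos : 0 < l.length := List.length_pos_of_ne_nil h.1
  refine (hp.minimalPeriod_le hpos).antisymm (not_lt.1 fun hlt => ?_)
  have h1 := isPeriodicPt_rotate.1 (Function.isPeriodicPt_minimalPeriod
    (fun w : List α => w.rotate 1) l)
  exact (hp.minimalPeriod_pos hpos).ne' (h.2 _ hlt h1)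

/-- The word `l` repeated `k` times. -/
def wordPow (l : List α) (k : ℕ) : List α := (List.replicate k l).flatten

theorem wordPow_succ (l : List α) (k : ℕ) : wordPow l (k + 1) = l ++ wordPow l k := by
  simp [wordPow, List.replicate_succ]

theorem length_wordPow (l : List α) (k : ℕ) : (wordPow l k).length = k * l.length := by
  simp [wordPow]

theorem rotate_one_wordPow (l : List α) (k : ℕ) :
    (wordPow l k).rotate 1 = wordPow (l.rotate 1) k := by
  cases l with
  | nil => simp [wordPow]
  | cons a l =>
    -- The conjugation identity `(a l) ^ k a = a (l a) ^ k`.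
    have key : ∀ k, wordPow (a :: l) k ++ [a] = a :: wordPow (l ++ [a]) k := by
      intro k
      induction k with
      | zero => simp [wordPow]
      | succ k ih =>
        rw [wordPow_succ, wordPow_succ, List.append_assoc, ih]
        simp
    cases k with
    | zero => simp [wordPow]
    | succ k =>
      rw [wordPow_succ, List.cons_append, List.rotate_cons_succ, List.rotate_zero,
        List.append_assoc, key, List.rotate_cons_succ, List.rotate_zero, wordPow_succ]
      simp

theorem rotate_wordPow (l : List α) (k j : ℕ) :
    (wordPow l k).rotate j = wordPow (l.rotate j) k := by
  induction j with
  | zero => simp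
  | succ j ih => rw [← List.rotate_rotate, ih, rotate_one_wordPow, List.rotate_rotate]

theorem wordPow_inj {l l' : List α} {k : ℕ} (hk : k ≠ 0) (hl : l.length = l'.length)
    (h : wordPow l k = wordPow l' k) : l = l' := by
  obtain ⟨k, rfl⟩ := Nat.exists_eq_succ_of_ne_zero hk
  rw [Nat.succ_eq_add_one, wordPow_succ, wordPow_succ] at h
  exact (List.append_inj h hl).1

/-- Rotation commutes with taking powers, and a nonzero power determines its root among words of
given length. The length of a primitive root can therefore be read off from the power. -/
theorem minimalPeriod_wordPow (l : List α) {k : ℕ} (hk : k ≠ 0) :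
    Function.minimalPeriod (fun w : List α => w.rotate 1) (wordPow l k) =
      Function.minimalPeriod (fun w : List α => w.rotate 1) l := by
  rw [Function.minimalPeriod_eq_minimalPeriod_iff]
  intro n
  rw [isPeriodicPt_rotate, isPeriodicPt_rotate, rotate_wordPow]
  exact ⟨fun h => wordPow_inj hk (by simp) h, fun h => by rw [h]⟩

/-- A primitive root of a word is unique. -/
theorem primitive_root_unique {u v : List α} {a b : ℕ} (hu : Primitive u) (hv : Primitive v)
    (ha : a ≠ 0) (hb : b ≠ 0) (h : wordPow u a = wordPow v b) : u = v := by
  have hlen : u.length = v.length := by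
    rw [← hu.minimalPeriod_eq, ← hv.minimalPeriod_eq, ← minimalPeriod_wordPow u ha, h,
      minimalPeriod_wordPow v hb]
  have hab : a = b := by
    have := congrArg List.length h
    rw [length_wordPow, length_wordPow, hlen] at this
    exact Nat.eq_of_mul_eq_mul_right (List.length_pos_of_ne_nil hv.1) this
  subst hab
  exact wordPow_inj ha hlen h

/-- Commutation makes `u` a prefix of `l`; once it is stripped, the remainder still commutes with
`u`. -/
theorem eq_wordPow_of_append_comm {u l : List α} {k : ℕ} (h : u ++ l = l ++ u)
    (hl : l.length = k * u.length) : l = wordPow u k := by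
  induction k generalizing l with
  | zero => simpa [wordPow] using hl
  | succ k ih =>
    have hp : u <+: l := by
      refine List.prefix_of_prefix_length_le ⟨l, rfl⟩ (h ▸ List.prefix_append l u) ?_
      rw [hl]
      exact Nat.le_mul_of_pos_left _ (Nat.succ_pos k)
    obtain ⟨l', rfl⟩ := hp
    rw [wordPow_succ, ← ih]
    · rw [List.append_assoc] at h
      exact List.append_cancel_left h
    · rw [List.length_append] at hl
      linarith

/-- Every nonempty word is a power of a primitive word. -/
theorem exists_primitive_root {l : List α} (hl : l ≠ []) :
    ∃ u : List α, Primitive u ∧ ∃ k, k ≠ 0 ∧ wordPow u k = l := by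
  set f := fun w : List α => w.rotate 1
  have hp : Function.IsPeriodicPt f l.length l := isPeriodicPt_rotate.2 (List.rotate_length l)
  have hpos : 0 < l.length := List.length_pos_of_ne_nil hl
  obtain ⟨k, hk⟩ := hp.minimalPeriod_dvd
  set d := Function.minimalPeriod f l with hd
  have hd0 : 0 < d := hp.minimalPeriod_pos hpos
  have hdl : d ≤ l.length := hp.minimalPeriod_le hpos
  have hk0 : k ≠ 0 := by rintro rfl; omega
  have hrot : l.rotate d = l :=
    isPeriodicPt_rotate.1 (Function.isPeriodicPt_minimalPeriod f l)
  -- The root is the initial segment whose length is the minimal rotation period.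
  have hulen : (l.take d).length = d := by simp [hdl]
  obtain ⟨j, rfl⟩ := Nat.exists_eq_succ_of_ne_zero hk0
  have hpow : wordPow (l.take d) (j + 1) = l := by
    rw [wordPow_succ, ← eq_wordPow_of_append_comm (l := l.drop d), List.take_append_drop]
    · rw [List.take_append_drop, ← List.rotate_eq_drop_append_take hdl, hrot]
    · rw [hulen, List.length_drop, hk, Nat.succ_eq_add_one, mul_comm j, mul_add, mul_one,
        Nat.add_sub_cancel]
  refine ⟨l.take d, ⟨?_, fun i hi hr => ?_⟩, j + 1, Nat.succ_ne_zero j, hpow⟩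
  · rw [← List.length_pos_iff, hulen]
    exact hd0
  -- A rotation fixing the root fixes its power `l`, so it cannot be shorter than the minimal
  -- period.
  · have h1 : Function.IsPeriodicPt f i l := by
      rw [isPeriodicPt_rotate]
      conv_lhs => rw [← hpow]
      rw [rotate_wordPow, hr, hpow]
    exact h1.eq_zero_of_lt_minimalPeriod (by rw [← hd]; omega)

end Words

open Quiver

/-! ### Embedding the fibres in their direct sum. -/

section Inclusion

variable {V : Type*} [Fintype V] [DecidableEq V] {n : V → ℕ}

/-- The inclusion of the summand `ℂ^{n a}` in the direct sum of all of them. -/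
def incl (n : V → ℕ) (a : V) : Matrix (Σ v, Fin (n v)) (Fin (n a)) ℂ :=
  (1 : Matrix (Σ v, Fin (n v)) (Σ v, Fin (n v)) ℂ).submatrix id (fun i => ⟨a, i⟩)

theorem transpose_incl_mul {m : Type*} (a : V) (X : Matrix (Σ v, Fin (n v)) m ℂ) :
    (incl n a).transpose * X = X.submatrix (fun i => ⟨a, i⟩) id := by
  ext i j
  simp [incl, Matrix.mul_apply, Matrix.one_apply]

theorem transpose_incl_mulVec (a : V) (f : (Σ v, Fin (n v)) → ℂ) :
    (incl n a).transpose.mulVec f = fun i => f ⟨a, i⟩ := by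
  ext i
  simp [incl, Matrix.mulVec, dotProduct, Matrix.one_apply]

theorem transpose_incl_mul_incl_self (a : V) : (incl n a).transpose * incl n a = 1 := by
  rw [transpose_incl_mul]
  ext i j
  simp [incl, Matrix.one_apply]

theorem transpose_incl_mul_incl_of_ne {a b : V} (h : a ≠ b) :
    (incl n a).transpose * incl n b = 0 := by
  rw [transpose_incl_mul]
  ext i j
  simp [incl, h]

end Inclusion

/-! ### Holonomy as a product of edge matrices. -/

section Paths

variable {V : Type*} [Quiver V] {n : V → ℕ}

theorem BasedCycle.edges_ne_nil (c : BasedCycle V) : c.edges ≠ [] := by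
  rw [← List.length_pos_iff, edges, length_edgeList]
  exact c.length_pos

section Fintype

variable [DecidableEq V] [Fintype V]

/-- The matrix of an edge, acting on the direct sum of all the fibres. -/
noncomputable def edgeMat (M : ∀ a b : V, (a ⟶ b) → Matrix (Fin (n a)) (Fin (n b)) ℂ)
    (e : Total V) : Matrix (Σ v, Fin (n v)) (Σ v, Fin (n v)) ℂ :=
  incl n e.left * M e.left e.right e.hom * (incl n e.right).transpose

/-- The product of the matrices of the edges of a word, which need not be well chained. -/
noncomputable def wordMat (M : ∀ a b : V, (a ⟶ b) → Matrix (Fin (n a)) (Fin (n b)) ℂ)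
    (l : List (Total V)) : Matrix (Σ v, Fin (n v)) (Σ v, Fin (n v)) ℂ :=
  (l.map (edgeMat M)).prod

variable (M : ∀ a b : V, (a ⟶ b) → Matrix (Fin (n a)) (Fin (n b)) ℂ)

theorem wordMat_concat (l : List (Total V)) (e : Total V) :
    wordMat M (l ++ [e]) = wordMat M l * edgeMat M e := by
  simp [wordMat]

/-- The inner inclusions cancel against their transposes. The empty path is excluded because the
empty product is the identity of the whole sum, not the projection onto one fibre. -/
theorem wordMat_edgeList {a b : V} (p : Path a b) (hp : 0 < p.length) :
    wordMat M (edgeList p) = incl n a * hol M p * (incl n b).transpose := by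
  induction p with
  | nil => simp at hp
  | cons p e ih =>
    rw [edgeList, wordMat_concat]
    rcases Nat.eq_zero_or_pos p.length with h0 | h0
    · obtain rfl := Path.eq_of_length_zero p h0
      obtain rfl := Path.eq_nil_of_length_zero p h0
      simp [edgeList, wordMat, hol, edgeMat]
    · rw [ih h0, hol, edgeMat]
      simp only [Matrix.mul_assoc]
      rw [← Matrix.mul_assoc (incl n _).transpose, transpose_incl_mul_incl_self, Matrix.one_mul]

theorem exists_path_of_wordMat_ne_zero {l : List (Total V)} (hl : l ≠ [])
    (h : wordMat M l ≠ 0) : ∃ (a b : V) (p : Path a b), edgeList p = l := by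
  induction l using List.reverseRecOn with
  | nil => exact absurd rfl hl
  | append_singleton l e ih =>
    obtain ⟨c, d, e⟩ := e
    rcases eq_or_ne l [] with rfl | hl'
    · exact ⟨c, d, Path.nil.cons e, rfl⟩
    · rw [wordMat_concat] at h
      obtain ⟨a, b, p, rfl⟩ := ih hl' (left_ne_zero_of_mul h)
      obtain rfl : b = c := by
        -- Two consecutive edges that do not chain meet in distinct, orthogonal summands, so the
        -- product vanishes.
        by_contra hbc
        apply h
        have hp : 0 < p.length := by
          rw [← length_edgeList]
          exact List.length_pos_of_ne_nil hl'
        rw [wordMat_edgeList M p hp, edgeMat]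
        simp only [Matrix.mul_assoc]
        rw [← Matrix.mul_assoc (incl n _).transpose, transpose_incl_mul_incl_of_ne hbc,
          Matrix.zero_mul, Matrix.mul_zero, Matrix.mul_zero]
      exact ⟨a, d, p.cons e, rfl⟩

theorem wordMat_wordPow (l : List (Total V)) (k : ℕ) :
    wordMat M (wordPow l k) = wordMat M l ^ k := by
  induction k with
  | zero => simp [wordPow, wordMat]
  | succ k ih =>
    rw [wordPow_succ, pow_succ', ← ih]
    simp [wordMat]

/-- A nonzero product forces the word to be a path. If its endpoints `a` and `b` differed, cyclicity
of the trace would bring out the factor `(incl n b)ᵀ * incl n a = 0`. -/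
theorem exists_basedCycle_of_trace_ne_zero {l : List (Total V)} {k : ℕ} (hl : l ≠ [])
    (hk : k ≠ 0) (h : (wordMat M l ^ k).trace ≠ 0) : ∃ c : BasedCycle V, c.edges = l := by
  have h0 : wordMat M l ≠ 0 := by
    intro h0
    simp [h0, hk] at h
  obtain ⟨a, b, p, rfl⟩ := exists_path_of_wordMat_ne_zero M hl h0
  have hp : 0 < p.length := by
    rw [← length_edgeList]
    exact List.length_pos_of_ne_nil hl
  obtain rfl : a = b := by
    by_contra hab
    apply h
    have hba := transpose_incl_mul_incl_of_ne (n := n) (Ne.symm hab)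
    obtain ⟨k, rfl⟩ := Nat.exists_eq_succ_of_ne_zero hk
    rw [wordMat_edgeList M p hp, Nat.succ_eq_add_one, pow_succ', Matrix.mul_assoc,
      Matrix.mul_assoc, Matrix.trace_mul_comm, Matrix.mul_assoc]
    rcases k with _ | k
    · rw [pow_zero, Matrix.mul_one, hba, Matrix.mul_zero, Matrix.trace_zero]
    · rw [pow_succ', Matrix.mul_assoc (incl n a), Matrix.mul_assoc (incl n a),
        ← Matrix.mul_assoc (incl n b).transpose (incl n a), hba, Matrix.zero_mul,
        Matrix.zero_mul, Matrix.mul_zero, Matrix.trace_zero]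
  exact ⟨⟨a, p, hp⟩, rfl⟩

theorem BasedCycle.trace_wordMat_pow (c : BasedCycle V) {k : ℕ} (hk : k ≠ 0) :
    (wordMat M c.edges ^ k).trace = (hol M c.path ^ k).trace := by
  have h : ∀ j, wordMat M c.edges ^ (j + 1) =
      incl n c.base * hol M c.path ^ (j + 1) * (incl n c.base).transpose := by
    intro j
    have h1 := wordMat_edgeList M c.path c.length_pos
    change wordMat M c.edges = _ at h1
    induction j with
    | zero => rw [zero_add, pow_one, pow_one, h1]
    | succ j ih =>
      rw [pow_succ, ih, h1, pow_succ (hol M c.path) (j + 1)]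
      simp only [Matrix.mul_assoc]
      rw [← Matrix.mul_assoc (incl n _).transpose, transpose_incl_mul_incl_self, Matrix.one_mul]
  obtain ⟨k, rfl⟩ := Nat.exists_eq_succ_of_ne_zero hk
  rw [Nat.succ_eq_add_one, h, Matrix.trace_mul_comm, ← Matrix.mul_assoc,
    transpose_incl_mul_incl_self, Matrix.one_mul]

end Fintype

/-! ### Prime cycles and their based representatives. -/

section PrimeCycles

/-- The cycle underlying a based cycle. -/
def BasedCycle.toQCycle (c : BasedCycle V) : QCycle V :=
  Quotient.mk (BasedCycle.rotationSetoid V) c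

/-- A based cycle representing a given cycle. -/
noncomputable def QCycle.out (C : QCycle V) : BasedCycle V := Quotient.out C

@[simp] theorem QCycle.toQCycle_out (C : QCycle V) : C.out.toQCycle = C := Quotient.out_eq C

theorem BasedCycle.valuation_eq_one_iff (c : BasedCycle V) :
    c.valuation = 1 ↔ Primitive c.edges := by
  have hpos : 0 < c.edges.length := List.length_pos_of_ne_nil (by
    rw [← List.length_pos_iff, edges, length_edgeList]
    exact c.length_pos)
  rw [valuation, Set.ncard_eq_one]
  constructor
  · rintro ⟨a, ha⟩
    have h0 : 0 ∈ ({a} : Set ℕ) := ha ▸ ⟨hpos, List.rotate_zero _⟩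
    refine ⟨List.ne_nil_of_length_pos hpos, fun i hi hr => ?_⟩
    have h1 : i ∈ ({a} : Set ℕ) := ha ▸ ⟨hi, hr⟩
    rw [Set.mem_singleton_iff] at h0 h1
    rw [h1, ← h0]
  · intro h
    refine ⟨0, Set.ext fun i => ⟨fun hi => h.2 i hi.1 hi.2, ?_⟩⟩
    rintro rfl
    exact ⟨hpos, List.rotate_zero _⟩

theorem BasedCycle.toQCycle_mem_primeCycles (c : BasedCycle V) :
    c.toQCycle ∈ primeCycles V ↔ Primitive c.edges :=
  c.valuation_eq_one_iff

/-- Every cyclic permutation of the edges of a based cycle comes from a based cycle. -/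
theorem BasedCycle.exists_edges_eq_rotate (c : BasedCycle V) (i : ℕ) :
    ∃ d : BasedCycle V, d.edges = c.edges.rotate i := by
  rw [← List.rotate_mod]
  set j := i % c.edges.length
  have hpos : 0 < c.edges.length := by
    rw [edges, length_edgeList]
    exact c.length_pos
  have hj : j ≤ c.edges.length := (Nat.mod_lt _ hpos).le
  obtain ⟨b, q, r, hp, hq, hr⟩ := exists_comp_of_edgeList_eq_append c.path
    (c.edges.take j) (c.edges.drop j) (List.take_append_drop j _).symm
  refine ⟨⟨b, r.comp q, ?_⟩, ?_⟩
  · have := c.length_pos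
    rw [hp, Path.length_comp] at this
    rw [Path.length_comp]
    omega
  · rw [List.rotate_eq_drop_append_take hj, edges, edgeList_comp, hq, hr]

theorem BasedCycle.toQCycle_eq_iff (c : BasedCycle V) (C : QCycle V) :
    c.toQCycle = C ↔ c.edges ~r C.out.edges := by
  conv_lhs => rw [← C.toQCycle_out]
  exact Quotient.eq

theorem image_edges_fiber (C : QCycle V) :
    BasedCycle.edges '' {c : BasedCycle V | c.toQCycle = C} =
      (fun i => C.out.edges.rotate i) ''
        (Finset.range C.out.edges.length : Set ℕ) := by
  ext l
  simp only [Set.mem_image, Set.mem_ofPred_eq, BasedCycle.toQCycle_eq_iff, Finset.coe_range, Set.mem_Iio]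
  constructor
  · rintro ⟨c, hc, rfl⟩
    obtain ⟨i, hi⟩ := hc.symm
    refine ⟨i % C.out.edges.length, Nat.mod_lt _ ?_, by rw [List.rotate_mod, hi]⟩
    rw [BasedCycle.edges, length_edgeList]
    exact C.out.length_pos
  · rintro ⟨i, -, rfl⟩
    obtain ⟨d, hd⟩ := C.out.exists_edges_eq_rotate i
    exact ⟨d, hd ▸ List.IsRotated.forall _ _, hd⟩

theorem finite_fiber (C : QCycle V) :
    {c : BasedCycle V | c.toQCycle = C}.Finite := by
  apply Set.Finite.of_finite_image _ (BasedCycle.edges_injective.injOn)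
  rw [image_edges_fiber]
  exact (Finset.finite_toSet _).image _

/-- Based representatives correspond to rotations of the edge sequence, and primitivity makes the
rotations by less than its length pairwise distinct. -/
theorem ncard_fiber {C : QCycle V} (hC : C ∈ primeCycles V) :
    {c : BasedCycle V | c.toQCycle = C}.ncard =
      C.out.edges.length := by
  have hprim : Primitive C.out.edges := by
    rw [← BasedCycle.toQCycle_mem_primeCycles, QCycle.toQCycle_out]
    exact hC
  rw [← Set.ncard_image_of_injective _ BasedCycle.edges_injective, image_edges_fiber,
    Set.InjOn.ncard_image, Set.ncard_coe_finset, Finset.card_range]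
  intro i hi j hj hij
  simp only [Finset.coe_range, Set.mem_Iio] at hi hj
  rw [← hprim.minimalPeriod_eq] at hi hj
  refine Function.iterate_injOn_Iio_minimalPeriod hi hj ?_
  simpa only [iterate_rotate_one] using hij

/-- A sum over prime based cycles of a function of the underlying cycle. -/
theorem sum_prime_basedCycle (hfin : (primeCycles V).Finite)
    (B : Finset (BasedCycle V)) (hB : ∀ c, c ∈ B ↔ Primitive c.edges)
    (g : BasedCycle V → ℂ) (hg : ∀ c d : BasedCycle V, c.edges ~r d.edges → g c = g d) :
    ∑ c ∈ B, g c =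
      ∑ C ∈ hfin.toFinset, (C.out.edges.length : ℂ) * g C.out := by
  classical
  rw [← Finset.sum_fiberwise_of_maps_to (t := hfin.toFinset)
    (g := BasedCycle.toQCycle)]
  · refine Finset.sum_congr rfl fun C hC => ?_
    rw [Set.Finite.mem_toFinset] at hC
    rw [Finset.sum_congr rfl (g := fun _ => g C.out), Finset.sum_const, nsmul_eq_mul,
      ← ncard_fiber hC, ← Set.ncard_coe_finset]
    · congr 3
      ext c
      simp only [Finset.coe_filter, Set.mem_ofPred_eq]
      refine and_iff_right_of_imp ?_
      rintro rfl
      exact (hB c).2 ((BasedCycle.toQCycle_mem_primeCycles c).1 hC)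
    · intro c hc
      exact hg _ _ ((BasedCycle.toQCycle_eq_iff c C).1 (Finset.mem_filter.1 hc).2)
  · intro c hc
    rw [Set.Finite.mem_toFinset]
    exact (BasedCycle.toQCycle_mem_primeCycles c).2 ((hB c).1 hc)

theorem finite_prime_basedCycle (hfin : (primeCycles V).Finite) :
    {c : BasedCycle V | Primitive c.edges}.Finite := by
  refine (hfin.preimage' (f := BasedCycle.toQCycle)
    fun C _ => finite_fiber C).subset ?_
  exact fun c hc => (BasedCycle.toQCycle_mem_primeCycles c).2 hc

end PrimeCycles

end Paths

/-! ### The trace formula. -/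

section Traces

variable {V : Type*} [Quiver V] [Fintype V] [∀ a b : V, Fintype (a ⟶ b)]
  [DecidableEq V] {n : V → ℕ}

/-- Edges as a disjoint union over their endpoints. -/
def sigmaEquivTotal (V : Type*) [Quiver V] : (Σ a b : V, a ⟶ b) ≃ Total V where
  toFun e := ⟨e.1, e.2.1, e.2.2⟩
  invFun e := ⟨e.left, e.right, e.hom⟩
  left_inv _ := rfl
  right_inv _ := rfl

noncomputable instance : Fintype (Total V) := Fintype.ofEquiv _ (sigmaEquivTotal V)

/-- The transition matrix, the sum of the matrices of all edges. -/
noncomputable def transMat (M : ∀ a b : V, (a ⟶ b) → Matrix (Fin (n a)) (Fin (n b)) ℂ) :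
    Matrix (Σ v, Fin (n v)) (Σ v, Fin (n v)) ℂ :=
  ∑ e : Total V, edgeMat M e

variable (M : ∀ a b : V, (a ⟶ b) → Matrix (Fin (n a)) (Fin (n b)) ℂ)

theorem transMat_eq_sum :
    transMat M = ∑ a, ∑ b, ∑ e : a ⟶ b, incl n a * M a b e * (incl n b).transpose := by
  rw [transMat, ← (sigmaEquivTotal V).sum_comp, Fintype.sum_sigma]
  refine Finset.sum_congr rfl fun a _ => ?_
  rw [Fintype.sum_sigma]
  rfl

theorem transMat_pow (k : ℕ) :
    transMat M ^ k = ∑ f : Fin k → Total V, wordMat M (List.ofFn f) := by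
  induction k with
  | zero => simp [wordMat]
  | succ k ih =>
    rw [pow_succ', ih, transMat, ← (Fin.consEquiv fun _ => Total V).sum_comp,
      Fintype.sum_prod_type, Finset.sum_mul_sum]
    refine Finset.sum_congr rfl fun e _ => Finset.sum_congr rfl fun f _ => ?_
    simp [wordMat, Fin.consEquiv]

/-- The words of length `k` with nonzero trace are among the powers `c ^ (k / d)` of based prime
cycles whose length `d` divides `k`. Grouping base points of one cycle gives the multiplicity `d`.
-/
theorem trace_transMat_pow (hfin : (primeCycles V).Finite) {k : ℕ} (hk : 0 < k) :
    (transMat M ^ k).trace = ∑ C ∈ hfin.toFinset,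
      if C.out.edges.length ∣ k then
        (C.out.edges.length : ℂ) *
          (hol M C.out.path ^ (k / C.out.edges.length)).trace
      else 0 := by
  classical
  set B := (finite_prime_basedCycle hfin).toFinset with hBdef
  have hB : ∀ c, c ∈ B ↔ Primitive c.edges := fun c => by simp [hBdef]
  have hdiv : ∀ {d : ℕ}, d ∣ k → k / d ≠ 0 := fun h =>
    (Nat.div_pos (Nat.le_of_dvd hk h) (Nat.pos_of_dvd_of_pos h hk)).ne'
  let g : BasedCycle V → ℂ := fun c =>
    if c.edges.length ∣ k then (hol M c.path ^ (k / c.edges.length)).trace else 0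
  have hg : ∀ c d : BasedCycle V, c.edges ~r d.edges → g c = g d := by
    intro c d h
    have hlen : c.edges.length = d.edges.length := h.perm.length_eq
    simp only [g, hlen]
    split_ifs with hdk
    · obtain ⟨q, r, hc, hd⟩ := BasedCycle.exists_comp_of_isRotated h
      obtain ⟨j, hj⟩ := Nat.exists_eq_succ_of_ne_zero (hdiv hdk)
      -- Moving the base point turns `Q R` into `R Q`; with this intertwining, powers of the two
      -- have the same trace although their sizes may differ.
      have key : ∀ {a b : ℕ} (Q : Matrix (Fin a) (Fin b) ℂ) (R : Matrix (Fin b) (Fin a) ℂ)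
          (j : ℕ), (Q * R) ^ j * Q = Q * (R * Q) ^ j := by
        intro a b Q R j
        induction j with
        | zero => simp
        | succ j ih => rw [pow_succ', Matrix.mul_assoc, ih, pow_succ']; simp [Matrix.mul_assoc]
      rw [hj, hc, hd, hol_comp, hol_comp, Nat.succ_eq_add_one, pow_succ, ← Matrix.mul_assoc, key,
        Matrix.mul_assoc, Matrix.trace_mul_comm, Matrix.mul_assoc, ← pow_succ]
    · rfl
  have hsum := sum_prime_basedCycle hfin B hB g hg
  simp only [g, mul_ite, mul_zero] at hsum
  rw [← hsum, transMat_pow, Matrix.trace_sum]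
  have hinj : Function.Injective (List.ofFn : (Fin k → Total V) → List (Total V)) :=
    List.ofFn_injective
  have hmap : ∑ f : Fin k → Total V, (wordMat M (List.ofFn f)).trace =
      ∑ l ∈ Finset.univ.map ⟨_, hinj⟩, (wordMat M l).trace := by
    rw [Finset.sum_map]
    rfl
  rw [hmap, ← Finset.sum_filter]
  symm
  have hlen : ∀ l : List (Total V), l ∈ Finset.univ.map ⟨_, hinj⟩ ↔ l.length = k := by
    intro l
    simp only [Finset.mem_map, Finset.mem_univ, true_and, Function.Embedding.coeFn_mk]
    constructor
    · rintro ⟨f, rfl⟩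
      simp
    · rintro rfl
      exact ⟨l.get, List.ofFn_get l⟩
  -- Uniqueness of primitive roots gives injectivity; existence shows that any word outside the
  -- image contributes zero.
  refine Finset.sum_of_injOn (fun c => wordPow c.edges (k / c.edges.length)) ?_ ?_ ?_ ?_
  · intro c hc d hd h
    simp only [Finset.coe_filter, Set.mem_ofPred_eq, hB] at hc hd
    exact BasedCycle.edges_injective
      (primitive_root_unique hc.1 hd.1 (hdiv hc.2) (hdiv hd.2) h)
  · intro c hc
    simp only [Finset.coe_filter, Set.mem_ofPred_eq] at hc
    rw [Finset.mem_coe, hlen, length_wordPow, Nat.div_mul_cancel hc.2]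
  · intro l hl hnot
    rw [hlen] at hl
    by_contra hne
    obtain ⟨u, hu, j, hj, rfl⟩ := exists_primitive_root (List.ne_nil_of_length_pos (hl ▸ hk))
    rw [wordMat_wordPow] at hne
    obtain ⟨c, rfl⟩ := exists_basedCycle_of_trace_ne_zero M hu.1 hj hne
    rw [length_wordPow] at hl
    refine hnot ⟨c, ?_, ?_⟩
    · simp only [Finset.coe_filter, Set.mem_ofPred_eq, hB]
      exact ⟨hu, hl ▸ Nat.dvd_mul_left _ _⟩
    · simp only
      rw [← hl, Nat.mul_div_cancel _ (List.length_pos_of_ne_nil hu.1)]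
  · intro c hc
    rw [wordMat_wordPow, c.trace_wordMat_pow M (hdiv (Finset.mem_filter.1 hc).2)]

theorem det_one_sub_transMat (hfin : (primeCycles V).Finite) :
    (1 - transMat M).det =
      ∏ C ∈ hfin.toFinset, (1 - hol M C.out.path).det := by
  refine det_one_sub_eq_prod_of_trace_pow _ _ (fun C : QCycle V => C.out.edges.length)
    (fun C => ?_) (fun C : QCycle V => hol M C.out.path)
    fun k hk => trace_transMat_pow M hfin hk
  exact (List.length_pos_of_ne_nil (BasedCycle.edges_ne_nil _)).ne'

end Traces

/-! ### Factoring the Laplacian through the transition matrix. -/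

section Laplacian

variable {V : Type*} [Quiver V] {n : V → ℕ}

theorem hol_smul (p : ∀ a b : V, (a ⟶ b) → ℂ)
    (U : ∀ a b : V, (a ⟶ b) → Matrix (Fin (n a)) (Fin (n b)) ℂ) {a b : V} (q : Path a b) :
    hol (fun a b e => p a b e • U a b e) q = q.weight (fun {a b} => p a b) • hol U q := by
  induction q with
  | nil => simp [hol]
  | cons q e ih => rw [hol, ih, hol, Path.weight_cons, Matrix.smul_mul, Matrix.mul_smul, smul_smul]

variable [Fintype V] [∀ a b : V, Fintype (a ⟶ b)]

theorem QCycle.eulerFactor_eq_det_hol (x : ∀ a b : V, (a ⟶ b) → ℂ)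
    (U : ∀ a b : V, (a ⟶ b) → Matrix (Fin (n a)) (Fin (n b)) ℂ) (C : QCycle V) :
    QCycle.eulerFactor x U C =
      (1 - hol (fun a b e => normWeight x a b e • U a b e) C.out.path).det := by
  conv_lhs => rw [← C.toQCycle_out]
  rw [hol_smul]
  rfl

variable [DecidableEq V]

theorem transMat_mulVec (M : ∀ a b : V, (a ⟶ b) → Matrix (Fin (n a)) (Fin (n b)) ℂ)
    (f : (Σ v, Fin (n v)) → ℂ) (v : V) (i : Fin (n v)) :
    (transMat M).mulVec f ⟨v, i⟩ =
      ∑ w, ∑ e : v ⟶ w, (M v w e).mulVec (fun j => f ⟨w, j⟩) i := by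
  have h : (incl n v).transpose * transMat M = ∑ w, ∑ e : v ⟶ w, M v w e * (incl n w).transpose := by
    rw [transMat_eq_sum, Matrix.mul_sum, Finset.sum_eq_single v]
    · simp only [Matrix.mul_sum]
      refine Finset.sum_congr rfl fun w _ => Finset.sum_congr rfl fun e _ => ?_
      rw [← Matrix.mul_assoc, ← Matrix.mul_assoc, transpose_incl_mul_incl_self, Matrix.one_mul]
    · intro b _ hb
      simp only [Matrix.mul_sum]
      refine Finset.sum_eq_zero fun w _ => Finset.sum_eq_zero fun e _ => ?_
      rw [← Matrix.mul_assoc, ← Matrix.mul_assoc, transpose_incl_mul_incl_of_ne hb.symm,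
        Matrix.zero_mul, Matrix.zero_mul]
    · simp
  have h2 := congrFun (transpose_incl_mulVec v ((transMat M).mulVec f)) i
  rw [← h2, Matrix.mulVec_mulVec, h]
  simp only [Matrix.sum_mulVec, Finset.sum_apply, ← Matrix.mulVec_mulVec, transpose_incl_mulVec]

theorem det_laplacian (x : ∀ a b : V, (a ⟶ b) → ℂ)
    (hx : ∀ (a b : V) (e : a ⟶ b), x a b e ≠ 0 → outWeight x a ≠ 0)
    (U : ∀ a b : V, (a ⟶ b) → Matrix (Fin (n a)) (Fin (n b)) ℂ) :
    LinearMap.det (laplacian x U) = (∏ a, outWeight x a ^ n a) *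
      (1 - transMat fun a b e => normWeight x a b e • U a b e).det := by
  set A := transMat fun a b e => normWeight x a b e • U a b e with hA
  let D : Matrix (Σ v, Fin (n v)) (Σ v, Fin (n v)) ℂ :=
    Matrix.diagonal fun q => outWeight x q.1
  let φ : ((Σ v, Fin (n v)) → ℂ) ≃ₗ[ℂ] (∀ v, Fin (n v) → ℂ) :=
    LinearEquiv.piCurry ℂ fun (v : V) (_ : Fin (n v)) => ℂ
  have hconj : laplacian x U =
      (φ : _ →ₗ[ℂ] _) ∘ₗ Matrix.toLin' (D * (1 - A)) ∘ₗ (φ.symm : _ →ₗ[ℂ] _) := by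
    refine LinearMap.ext fun f => funext fun v => funext fun i => ?_
    change _ = (D * (1 - A)).mulVec (fun q => f q.1 q.2) ⟨v, i⟩
    rw [← Matrix.mulVec_mulVec, Matrix.mulVec_diagonal, Matrix.sub_mulVec, Matrix.one_mulVec,
      Pi.sub_apply, hA, transMat_mulVec]
    -- If `z_v = 0`, division by zero makes `p_e` zero, and `hx` forces `x_e = 0` as well.
    have hw : ∀ (w : V) (e : v ⟶ w), outWeight x v * normWeight x v w e = x v w e := by
      intro w e
      by_cases hz : outWeight x v = 0
      · rw [hz, zero_mul]
        by_contra hne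
        exact hx v w e (Ne.symm hne) hz
      · rw [normWeight, mul_div_cancel₀ _ hz]
    have hL : laplacian x U f v i =
        ∑ w, ∑ e : v ⟶ w, x v w e * (f v i - (U v w e).mulVec (f w) i) := by
      simp [laplacian, Finset.sum_apply]
    rw [hL, mul_sub, Finset.mul_sum]
    simp only [mul_sub, Finset.sum_sub_distrib, Finset.mul_sum, Matrix.smul_mulVec, Pi.smul_apply,
      smul_eq_mul, ← mul_assoc, hw, ← Finset.sum_mul]
    rfl
  rw [hconj, LinearMap.det_conj, LinearMap.det_toLin', Matrix.det_mul, Matrix.det_diagonal,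
    Fintype.prod_sigma]
  simp

end Laplacian

end QuiverEuler

theorem theorem7p1 {V : Type*} [Quiver V] [Fintype V] [∀ a b : V, Fintype (a ⟶ b)]
    (hloop : ∀ a : V, IsEmpty (a ⟶ a))
    (n : V → ℕ) (hn : ∀ a, 1 ≤ n a)
    (x : ∀ a b : V, (a ⟶ b) → ℂ)
    (hx : ∀ (a b : V) (e : a ⟶ b), x a b e ≠ 0 → QuiverEuler.outWeight x a ≠ 0)
    (U : ∀ a b : V, (a ⟶ b) → Matrix (Fin (n a)) (Fin (n b)) ℂ)
    (hfin : (QuiverEuler.primeCycles V).Finite) :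
    LinearMap.det (QuiverEuler.laplacian x U) =
      (∏ a, QuiverEuler.outWeight x a ^ n a) *
        ∏ c ∈ hfin.toFinset, QuiverEuler.QCycle.eulerFactor x U c := by
  classical
  rw [QuiverEuler.det_laplacian x hx U, QuiverEuler.det_one_sub_transMat _ hfin]
  congr 1
  exact Finset.prod_congr rfl fun C _ => (QuiverEuler.QCycle.eulerFactor_eq_det_hol x U C).symm
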